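/- A \emph{stabilisation semigroup} $\langle S,\cdot,\le,\sharp\rangle$ is a finite semigroup $\langle S,\cdot\rangle$ with a partial order $\le$ compatible with the product ($a\le a'$ and $b\le b'$ imply $a\cdot b\le a'\cdot b'$), and a map $\sharp\colon E(S)\to E(S)$ on the set $E(S)$ of idempotents of $S$, such that: $e\le f$ implies $e^\sharp\le f^\sharp$ for all $e,f\in E(S)$; $(a\cdot b)^\sharp=a\cdot(b\cdot a)^\sharp\cdot b$ whenever $a\cdot b$ and $b\cdot a$ are both idempotent; and $e^\sharp\le e$ and $(e^\sharp)^\sharp=e^\sharp$ for all $e\in E(S)$. Let $n\ge 0$ be an integer and let $u=a_1\cdots a_l\in S^+$ be a non-empty word. An \emph{$n$-under-computation} for $u$ is a finite ordered unranked tree with exactly $l$ leaves, each node $x$ of which is labelled by an element $v(x)\in S$, such that every node $x$ with children $y_1,\dots,y_k$ (from left to right) satisfies one of the following: (leaf) $k=0$ and $v(x)\le a_m$, where $x$ is the $m$-th leaf from the left; (binary node) $k=2$ and $v(x)\le v(y_1)\cdot v(y_2)$; (idempotent node) $2\le k\le n$ and $v(x)\le e$, where $e=v(y_1)=\dots=v(y_k)\in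 E(S)$; (stabilisation node) $k>n$, $k\geq 1$ and $v(x)\le e^\sharp$, where $e=v(y_1)=\dots=v(y_k)\in E(S)$. An \emph{$n$-over-computation} for $u$ is defined in the same way, with $v(x)\le$ replaced everywhere by $v(x)\ge$. The \emph{value} of such a tree is the label of its root, and its \emph{height} is the maximal number of edges on a path from the root to a leaf (a single leaf has height $0$). \textbf{Theorem.} Let $S$ be a stabilisation semigroup. For every integer $p\ge 0$ there exists a polynomial $\alpha\colon\mathbb N\to\mathbb N$ with coefficients in $\mathbb N$ such that, for every $n\in\mathbb N$, every word $u\in S^+$, every $n$-under-computation for $u$ of value $a$ and height at most $p$, and every $\alpha(n)$-over-computation for $u$ of value $b$ (of any height), we have $a\le b$. -/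

import Mathlib

/-- A stabilisation semigroup: a finite ordered semigroup together with a map `stab`
(written `♯` on paper) from idempotents to idempotents that is monotone, consistent,
decreasing and idempotent. -/
class StabilisationSemigroup (S : Type*) extends Semigroup S, PartialOrder S where
  finite_carrier : Finite S
  mul_le_mul_of_le : ∀ a a' b b' : S, a ≤ a' → b ≤ b' → a * b ≤ a' * b'
  stab : {e : S // IsIdempotentElem e} → {e : S // IsIdempotentElem e}
  stab_mono : ∀ e f : {e : S // IsIdempotentElem e},
    (e : S) ≤ (f : S) → (stab e : S) ≤ (stab f : S)
  stab_consistent : ∀ (a b : S) (hab : IsIdempotentElem (a * b)) (hba : IsIdempotentElem (b * a)),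
    (stab ⟨a * b, hab⟩ : S) = a * (stab ⟨b * a, hba⟩ : S) * b
  stab_le : ∀ e : {e : S // IsIdempotentElem e}, (stab e : S) ≤ (e : S)
  stab_stab : ∀ e : {e : S // IsIdempotentElem e}, stab (stab e) = stab e

/-- Finite ordered unranked trees whose nodes are labelled by elements of `S`.
`node v k c` has root label `v` and the `k` children `c 0, …, c (k - 1)`, from left to right;
it is a leaf when `k = 0`. -/
inductive ValuedTree (S : Type*) where
  | node (v : S) (k : ℕ) (c : Fin k → ValuedTree S) : ValuedTree S

namespace ValuedTree

variable {S : Type*}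

/-- The value of a tree is the label of its root. -/
def value : ValuedTree S → S
  | node v _ _ => v

/-- The height of a tree; leaves do not count, so a single leaf has height `0`. -/
def height : ValuedTree S → ℕ
  | node _ _ c => Finset.univ.sup fun i => (c i).height + 1

/-- The labels of the leaves, read from left to right. -/
def leafValues : ValuedTree S → List S
  | node v 0 _ => [v]
  | node _ (_ + 1) c => (List.ofFn fun i => (c i).leafValues).flatten

/-- Every inner node of label `v`, whose children have the labels `y₁, …, y_k` (`k ≥ 1`) from
left to right, satisfies `P v [y₁, …, y_k]`. -/
def ForallInner (P : S → List S → Prop) : ValuedTree S → Prop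
  | node v k c =>
    (k ≠ 0 → P v (List.ofFn fun i => (c i).value)) ∧ ∀ i, (c i).ForallInner P

end ValuedTree

/-- The three kinds of inner nodes at threshold `n`, for a node of value `v` with children of
values `ys`. The relation `r` is `≤` for under-computations and `≥` for over-computations. -/
def InnerNodeRule {S : Type*} [StabilisationSemigroup S] (r : S → S → Prop) (n : ℕ)
    (v : S) (ys : List S) : Prop :=
  (∃ y₁ y₂ : S, ys = [y₁, y₂] ∧ r v (y₁ * y₂)) ∨
  (∃ e : {e : S // IsIdempotentElem e},
    2 ≤ ys.length ∧ ys.length ≤ n ∧ (∀ y ∈ ys, y = (e : S)) ∧ r v (e : S)) ∨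
  (∃ e : {e : S // IsIdempotentElem e},
    n < ys.length ∧ (∀ y ∈ ys, y = (e : S)) ∧
      r v (StabilisationSemigroup.stab e : S))

/-- `T` is an `n`-under-computation for the word `u`: it has as many leaves as `u` has letters,
the value of the `m`-th leaf is at most the `m`-th letter, and every inner node is a binary,
idempotent or stabilisation node. -/
def IsUnderComputation {S : Type*} [StabilisationSemigroup S] (n : ℕ) (T : ValuedTree S)
    (u : List S) : Prop :=
  List.Forall₂ (fun v a => v ≤ a) T.leafValues u ∧
    T.ForallInner (InnerNodeRule (fun v a => v ≤ a) n)

/-- `T` is an `n`-over-computation for the word `u`: as for under-computations, with the value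
of every node at least, instead of at most, the prescribed element. -/
def IsOverComputation {S : Type*} [StabilisationSemigroup S] (n : ℕ) (T : ValuedTree S)
    (u : List S) : Prop :=
  List.Forall₂ (fun v a => v ≥ a) T.leafValues u ∧
    T.ForallInner (InnerNodeRule (fun v a => v ≥ a) n)

/-! From an under-computation `T` one builds a function `F` on the intervals of positions of the
word which every over-computation must respect (`Extends`). It satisfies `F a c ≤ F a b * F b c`,
lies below the leaves of `T` on single letters and above the value of `T` on the whole word, and
there is an `N` such that more than `N` consecutive intervals of value at most an idempotent `f`
have union of value at most `f♯` (`StabilisesAfter`). Induction on an `N`-over-computation then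
shows that `F` on the interval of each node is at most its label (`le_value_of_forallInner`); at the
root this is the theorem.

`F` is built by induction on the height of `T` (`exists_extends`). An interval cuts the children of
the root into a suffix of one child, a run of whole children and a prefix of another; `glue`
multiplies the three values. Each level turns `N` into `(N + 1) * L` with `L` linear in `n`, whence
a polynomial. The crux is `glue_idempotentBlock_le_stab`: a pigeonhole on prefix values gives `c`,
`d` with `e ≤ c * d` and `d * e♯ * c ≤ f`, and the ordered form of consistency,
`stab_le_mul_stab_mul`, brings `f♯` into the product. -/

open StabilisationSemigroup

/-! ### Consistency of the stabilisation in ordered form -/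

namespace StabilisationSemigroup

variable {S : Type*} [StabilisationSemigroup S]

instance : Finite S := finite_carrier

instance : MulLeftMono S := ⟨fun a _ _ h => mul_le_mul_of_le a a _ _ le_rfl h⟩

instance : MulRightMono S := ⟨fun a _ _ h => mul_le_mul_of_le _ _ a a h le_rfl⟩

lemma mul_stab (e : {e : S // IsIdempotentElem e}) : (e : S) * stab e = stab e := by
  have he : (e : S) * e = e := e.2
  have h := stab_consistent (e : S) e (by rw [he]; exact e.2) (by rw [he]; exact e.2)
  simp only [he] at h
  calc (e : S) * stab e = e * (e * stab e * e) := by rw [← h]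
    _ = e * e * stab e * e := by simp only [mul_assoc]
    _ = stab e := by rw [he, ← h]

lemma stab_mul (e : {e : S // IsIdempotentElem e}) : (stab e : S) * e = stab e := by
  have he : (e : S) * e = e := e.2
  have h := stab_consistent (e : S) e (by rw [he]; exact e.2) (by rw [he]; exact e.2)
  simp only [he] at h
  calc (stab e : S) * e = (e * stab e * e) * e := by rw [← h]
    _ = e * stab e * (e * e) := by simp only [mul_assoc]
    _ = stab e := by rw [he, ← h]

/-- In a finite semigroup, every non-empty set closed under the sandwich product
`b, b' ↦ b * a * b'` contains an idempotent of that product. -/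
lemma exists_sandwich_idempotent {M : Type*} [Semigroup M] [Finite M] (a : M) (Z : Set M)
    (hne : Z.Nonempty) (hZ : ∀ b ∈ Z, ∀ b' ∈ Z, b * a * b' ∈ Z) :
    ∃ b ∈ Z, b * a * b = b := by
  let sg : Semigroup Z :=
    { mul := fun b b' => ⟨b * a * b', hZ _ b.2 _ b'.2⟩
      mul_assoc := fun x y z => Subtype.ext (by
        change (x * a * y) * a * (z : M) = x * a * (y * a * z)
        simp only [mul_assoc]) }
  let top : TopologicalSpace Z := ⊥
  have disc : DiscreteTopology Z := ⟨rfl⟩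
  have : Nonempty Z := hne.to_subtype
  obtain ⟨b, hb⟩ := exists_idempotent_of_compact_t2_of_continuous_mul_left (M := Z)
    (fun _ => continuous_of_discreteTopology)
  exact ⟨b, b.2, congrArg Subtype.val hb⟩

/-- Consistency of the stabilisation, up to the order. -/
lemma stab_le_mul_stab_mul {e f : {e : S // IsIdempotentElem e}} {a b : S}
    (hab : (e : S) ≤ a * b) (hba : b * a ≤ f) : (stab e : S) ≤ a * stab f * b := by
  have he : (e : S) * e = e := e.2
  have hf : (f : S) * f = f := f.2
  -- Consistency needs both products idempotent, so `b` is replaced by some `c` with `c * a * c =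
  -- c`. The condition `f * c ≤ f * b` allows a return to `b` at the end, since `f♯` absorbs `f`.
  obtain ⟨c, ⟨h1, h2, h3⟩, hc⟩ := exists_sandwich_idempotent a
    {c | (e : S) ≤ a * c ∧ c * a ≤ f ∧ (f : S) * c ≤ f * b} ⟨b, hab, hba, le_rfl⟩ (by
      rintro c ⟨h1, h2, h3⟩ c' ⟨h1', h2', h3'⟩
      refine ⟨?_, ?_, ?_⟩
      · calc (e : S) = e * e := he.symm
          _ ≤ (a * c) * (a * c') := mul_le_mul' h1 h1'
          _ = a * (c * a * c') := by simp only [mul_assoc]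
      · calc c * a * c' * a = (c * a) * (c' * a) := by simp only [mul_assoc]
          _ ≤ f * f := mul_le_mul' h2 h2'
          _ = f := hf
      · calc (f : S) * (c * a * c') = f * ((c * a) * c') := by simp only [mul_assoc]
          _ ≤ f * (f * c') := by gcongr
          _ = f * c' := by rw [← mul_assoc, hf]
          _ ≤ f * b := h3')
  have hac : IsIdempotentElem (a * c) := by
    change a * c * (a * c) = a * c
    rw [mul_assoc, ← mul_assoc c, hc]
  have hca : IsIdempotentElem (c * a) := by
    change c * a * (c * a) = c * a
    rw [← mul_assoc, hc]
  calc (stab e : S) ≤ stab ⟨a * c, hac⟩ := stab_mono _ _ h1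
    _ = a * stab ⟨c * a, hca⟩ * c := stab_consistent _ _ _ _
    _ ≤ a * stab f * c := by gcongr; exact stab_mono _ _ h2
    _ = a * stab f * (f * c) := by rw [← mul_assoc, mul_assoc a _ (f : S), stab_mul]
    _ ≤ a * stab f * (f * b) := by gcongr
    _ = a * stab f * b := by rw [← mul_assoc, mul_assoc a _ (f : S), stab_mul]

end StabilisationSemigroup

/-! ### Adjoining a unit as the value of empty intervals -/

namespace WithOne

variable {S : Type*}

/-- The order on `WithOne S` in which the added unit is comparable only to itself. -/
instance [PartialOrder S] : PartialOrder (WithOne S) where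
  le a b := a = b ∨ ∃ x y : S, a = x ∧ b = y ∧ x ≤ y
  le_refl a := Or.inl rfl
  le_trans := by
    rintro a b c (rfl | ⟨x, y, rfl, rfl, h⟩) (rfl | ⟨x', y', h', rfl, h''⟩)
    · exact Or.inl rfl
    · exact Or.inr ⟨x', y', h', rfl, h''⟩
    · exact Or.inr ⟨x, y, rfl, rfl, h⟩
    · rw [WithOne.coe_inj] at h'
      exact Or.inr ⟨x, y', rfl, rfl, h.trans (h' ▸ h'')⟩
  le_antisymm := by
    rintro a b (rfl | ⟨x, y, rfl, rfl, h⟩) (h0 | ⟨x', y', h1, h2, h3⟩)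
    · rfl
    · rfl
    · exact h0.symm
    · rw [WithOne.coe_inj] at h1 h2 ⊢
      subst h1 h2
      exact le_antisymm h h3

lemma coe_le_coe [PartialOrder S] {x y : S} : (x : WithOne S) ≤ y ↔ x ≤ y := by
  constructor
  · rintro (h | ⟨a, b, h1, h2, h⟩)
    · exact (WithOne.coe_inj.1 h).le
    · rw [WithOne.coe_inj] at h1 h2
      exact h1 ▸ h2 ▸ h
  · exact fun h => Or.inr ⟨x, y, rfl, rfl, h⟩

/-- Keeps empty intervals, of value `1`, from being counted among intervals of value at most an
idempotent of `S`. -/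
lemma not_one_le_coe [PartialOrder S] (x : S) : ¬ (1 : WithOne S) ≤ x := by
  rintro (h | ⟨a, b, h1, -⟩)
  · exact WithOne.one_ne_coe h
  · exact WithOne.one_ne_coe h1

variable [StabilisationSemigroup S]

instance : MulLeftMono (WithOne S) := ⟨by
  rintro a b c (rfl | ⟨x, y, rfl, rfl, h⟩)
  · exact le_rfl
  · induction a with
    | one => simpa [coe_le_coe] using h
    | coe a =>
      change (a : WithOne S) * x ≤ a * y
      rw [← WithOne.coe_mul, ← WithOne.coe_mul, coe_le_coe]
      gcongr⟩

instance : MulRightMono (WithOne S) := ⟨by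
  rintro a b c (rfl | ⟨x, y, rfl, rfl, h⟩)
  · exact le_rfl
  · induction a with
    | one => simpa [Function.swap, coe_le_coe] using h
    | coe a =>
      change (x : WithOne S) * a ≤ y * a
      rw [← WithOne.coe_mul, ← WithOne.coe_mul, coe_le_coe]
      gcongr⟩

instance : Finite (WithOne S) := inferInstanceAs (Finite (Option S))

end WithOne

/-- The index `i` of the block `[o i, o (i + 1))` that contains `a`, for strictly increasing
block boundaries `o`. -/
def blockIndex (o : ℕ → ℕ) (a : ℕ) : ℕ := Nat.findGreatest (fun i => o i ≤ a) a

section blockIndex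

variable {o : ℕ → ℕ}

lemma apply_blockIndex_le (h0 : o 0 = 0) (a : ℕ) : o (blockIndex o a) ≤ a :=
  Nat.findGreatest_spec (P := fun i => o i ≤ a) (Nat.zero_le a) (by simp [h0])

lemma lt_apply_blockIndex_succ (ho : StrictMono o) (a : ℕ) : a < o (blockIndex o a + 1) := by
  by_contra! h
  have h1 : blockIndex o a + 1 ≤ a := (ho.id_le _).trans h
  have := Nat.le_findGreatest (P := fun i => o i ≤ a) h1 h
  exact absurd this (Nat.not_succ_le_self _)

lemma blockIndex_eq (ho : StrictMono o) (h0 : o 0 = 0) {a i : ℕ}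
    (h1 : o i ≤ a) (h2 : a < o (i + 1)) : blockIndex o a = i := by
  have h3 := apply_blockIndex_le h0 a
  have h4 := lt_apply_blockIndex_succ ho a
  have h5 : i < blockIndex o a + 1 := ho.lt_iff_lt.1 (h1.trans_lt h4)
  have h6 : blockIndex o a < i + 1 := ho.lt_iff_lt.1 (h3.trans_lt h2)
  omega

lemma blockIndex_apply (ho : StrictMono o) (h0 : o 0 = 0) (i : ℕ) : blockIndex o (o i) = i :=
  blockIndex_eq ho h0 le_rfl (ho (Nat.lt_succ_self i))

lemma blockIndex_mono (ho : StrictMono o) (h0 : o 0 = 0) {a b : ℕ}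
    (h : a ≤ b) : blockIndex o a ≤ blockIndex o b := by
  have h3 := apply_blockIndex_le h0 a
  have h4 := lt_apply_blockIndex_succ ho b
  exact Nat.lt_succ_iff.1 (ho.lt_iff_lt.1 ((h3.trans h).trans_lt h4))

end blockIndex

/-! ### Submultiplicative interval functions and their gluing -/

/-- The interval function obtained from functions `G i` on the blocks `[o i, o (i + 1))` and a
function `m` on the intervals of block indices. -/
def glue {M : Type*} [Mul M] (o : ℕ → ℕ) (G : ℕ → ℕ → ℕ → M) (m : ℕ → ℕ → M) (a b : ℕ) : M :=
  if blockIndex o a = blockIndex o b then G (blockIndex o a) a b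
  else G (blockIndex o a) a (o (blockIndex o a + 1)) *
    m (blockIndex o a + 1) (blockIndex o b) * G (blockIndex o b) (o (blockIndex o b)) b

/-- An interval function `F` is submultiplicative if it is `1` on empty intervals and
`F a c ≤ F a b * F b c`. -/
structure IsSubmul {M : Type*} [Monoid M] [Preorder M] (F : ℕ → ℕ → M) : Prop where
  self : ∀ a, F a a = 1
  le_mul : ∀ a b c, a ≤ b → b ≤ c → F a c ≤ F a b * F b c

section glue

variable {M : Type*} [Monoid M] {o : ℕ → ℕ} {G : ℕ → ℕ → ℕ → M} {m : ℕ → ℕ → M}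

lemma glue_of_eq {a b : ℕ} (h : blockIndex o a = blockIndex o b) :
    glue o G m a b = G (blockIndex o a) a b := if_pos h

lemma glue_of_ne {a b : ℕ} (h : blockIndex o a ≠ blockIndex o b) :
    glue o G m a b = G (blockIndex o a) a (o (blockIndex o a + 1)) *
      m (blockIndex o a + 1) (blockIndex o b) * G (blockIndex o b) (o (blockIndex o b)) b :=
  if_neg h

variable [Preorder M] [MulLeftMono M] [MulRightMono M]

/-- The essential case has `a`, `b`, `c` in three distinct blocks: the factor `m j (j + 1)` of the
block containing `b` is split off, replaced by `G j` on that whole block through `hmG`, and cut at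
`b`. -/
lemma IsSubmul.glue (ho : StrictMono o) (h0 : o 0 = 0) (hG : ∀ i, IsSubmul (G i))
    (hm : IsSubmul m) (hmG : ∀ i, m i (i + 1) ≤ G i (o i) (o (i + 1))) :
    IsSubmul (glue o G m) where
  self a := by rw [glue_of_eq rfl, (hG _).self]
  le_mul a b c hab hbc := by
    have h1 := blockIndex_mono ho h0 hab
    have h2 := blockIndex_mono ho h0 hbc
    have h3 := (lt_apply_blockIndex_succ ho b).le
    have h4 := apply_blockIndex_le h0 b
    by_cases hab' : blockIndex o a = blockIndex o b <;>
      by_cases hbc' : blockIndex o b = blockIndex o c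
    · rw [glue_of_eq (hab'.trans hbc'), glue_of_eq hab', glue_of_eq hbc', ← hab']
      exact (hG _).le_mul _ _ _ hab hbc
    · rw [glue_of_ne (hab' ▸ hbc'), glue_of_eq hab', glue_of_ne hbc', hab', ← mul_assoc,
        ← mul_assoc]
      gcongr
      exact (hG _).le_mul _ _ _ hab h3
    · rw [glue_of_ne (hbc' ▸ hab'), glue_of_ne hab', glue_of_eq hbc', hbc', mul_assoc _ _ (G _ b c)]
      gcongr
      rw [hbc'] at h4
      exact (hG _).le_mul _ _ _ h4 hbc
    · have hac : blockIndex o a ≠ blockIndex o c := by omega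
      rw [glue_of_ne hac, glue_of_ne hab', glue_of_ne hbc']
      set i := blockIndex o a
      set j := blockIndex o b
      set k := blockIndex o c
      calc G i a (o (i + 1)) * m (i + 1) k * G k (o k) c
          ≤ G i a (o (i + 1)) * (m (i + 1) j * (m j (j + 1) * m (j + 1) k)) * G k (o k) c := by
            gcongr
            refine (hm.le_mul _ j _ (by omega) (by omega)).trans ?_
            gcongr
            exact hm.le_mul _ _ _ (by omega) (by omega)
        _ ≤ G i a (o (i + 1)) * (m (i + 1) j * ((G j (o j) b * G j b (o (j + 1))) *
              m (j + 1) k)) * G k (o k) c := by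
            gcongr
            exact (hmG j).trans ((hG j).le_mul _ _ _ h4 h3)
        _ = _ := by simp only [mul_assoc]

end glue

section product

variable {M : Type*} [Monoid M] [Preorder M]

/-- The products of the consecutive terms of a sequence form a submultiplicative function. -/
lemma isSubmul_prod (v : ℕ → M) :
    IsSubmul fun s t => ((List.range' s (t - s)).map v).prod where
  self a := by simp
  le_mul a b c hab hbc := by
    rw [← List.prod_append, ← List.map_append]
    obtain ⟨x, rfl⟩ := Nat.exists_eq_add_of_le hab
    obtain ⟨y, rfl⟩ := Nat.exists_eq_add_of_le hbc
    have h1 : a + x + y - a = x + y := by omega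
    have h2 : a + x - a = x := by omega
    have h3 : a + x + y - (a + x) = y := by omega
    rw [h1, h2, h3, List.range'_append_1]

lemma IsSubmul.translate {F : ℕ → ℕ → M} (hF : IsSubmul F) (s : ℕ) :
    IsSubmul fun a b => F (a - s) (b - s) where
  self _ := hF.self _
  le_mul a b c hab hbc := hF.le_mul _ _ _ (by omega) (by omega)

end product

/-! ### Stabilisation of glued interval functions -/

section stabilisation

variable {S : Type*} [StabilisationSemigroup S]

lemma coe_mul_self (e : {e : S // IsIdempotentElem e}) :
    ((e : S) : WithOne S) * (e : S) = (e : S) := by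
  rw [← WithOne.coe_mul, e.2]

lemma coe_mul_stab (e : {e : S // IsIdempotentElem e}) :
    ((e : S) : WithOne S) * (stab e : S) = (stab e : S) := by
  rw [← WithOne.coe_mul, mul_stab]

lemma coe_stab_mul (e : {e : S // IsIdempotentElem e}) :
    ((stab e : S) : WithOne S) * (e : S) = (stab e : S) := by
  rw [← WithOne.coe_mul, stab_mul]

lemma coe_stab_le (e : {e : S // IsIdempotentElem e}) :
    ((stab e : S) : WithOne S) ≤ (e : S) := WithOne.coe_le_coe.2 (stab_le e)

lemma coe_stab_le_mul_stab_mul {e f : {e : S // IsIdempotentElem e}} {a b : WithOne S}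
    (hab : ((e : S) : WithOne S) ≤ a * b) (hba : b * a ≤ ((f : S) : WithOne S)) :
    ((stab e : S) : WithOne S) ≤ a * (stab f : S) * b := by
  induction a with
  | one =>
    rw [one_mul] at hab ⊢
    rw [mul_one] at hba
    rw [← coe_stab_mul e]
    have := stab_mono e f (WithOne.coe_le_coe.1 (hab.trans hba))
    exact mul_le_mul' (WithOne.coe_le_coe.2 this) hab
  | coe a =>
    induction b with
    | one =>
      rw [mul_one] at hab ⊢
      rw [one_mul] at hba
      rw [← coe_mul_stab e]
      have := stab_mono e f (WithOne.coe_le_coe.1 (hab.trans hba))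
      exact mul_le_mul' hab (WithOne.coe_le_coe.2 this)
    | coe b =>
      rw [← WithOne.coe_mul, WithOne.coe_le_coe] at hab hba
      rw [← WithOne.coe_mul, ← WithOne.coe_mul, WithOne.coe_le_coe]
      exact stab_le_mul_stab_mul hab hba

/-- The value of a block of `t - s` consecutive children of value `e`, at threshold `n`. -/
noncomputable def idempotentBlock (n : ℕ) (e : {e : S // IsIdempotentElem e}) (s t : ℕ) : WithOne S :=
  if t ≤ s then 1 else if t - s ≤ n then (e : S) else (stab e : S)

lemma stab_le_idempotentBlock {n : ℕ} {e : {e : S // IsIdempotentElem e}} {s t : ℕ} (h : s < t) :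
    ((stab e : S) : WithOne S) ≤ idempotentBlock n e s t := by
  rw [idempotentBlock, if_neg (not_le.2 h)]
  split_ifs
  · exact coe_stab_le e
  · exact le_rfl

lemma idempotentBlock_le {n : ℕ} {e : {e : S // IsIdempotentElem e}} {s t : ℕ} (h : s < t) :
    idempotentBlock n e s t ≤ ((e : S) : WithOne S) := by
  rw [idempotentBlock, if_neg (not_le.2 h)]
  split_ifs
  · exact le_rfl
  · exact coe_stab_le e

/-- A run of at most `n` children has only parts of value `e`; a longer one has value `e♯ = e♯ *
e♯`, and `e♯` is below the value of every non-empty part. -/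
lemma isSubmul_idempotentBlock (n : ℕ) (e : {e : S // IsIdempotentElem e}) :
    IsSubmul (idempotentBlock n e) where
  self a := by simp [idempotentBlock]
  le_mul a b c hab hbc := by
    rcases hab.eq_or_lt with rfl | hab
    · simp [idempotentBlock]
    rcases hbc.eq_or_lt with rfl | hbc
    · simp [idempotentBlock]
    by_cases h : c - a ≤ n
    · simp only [idempotentBlock, if_neg (not_le.2 hab), if_neg (not_le.2 hbc),
        if_neg (not_le.2 (hab.trans hbc)), if_pos h, if_pos (show c - b ≤ n by omega),
        if_pos (show b - a ≤ n by omega), coe_mul_self]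
      exact le_rfl
    · rw [idempotentBlock, if_neg (by omega), if_neg h]
      have : ((stab e : S) : WithOne S) = (stab e : S) * (stab e : S) := (coe_mul_self (stab e)).symm
      rw [this]
      exact mul_le_mul' (stab_le_idempotentBlock hab) (stab_le_idempotentBlock hbc)

/-- `F` sends every concatenation of more than `N` intervals inside `[0, l]` of values below an
idempotent to a value below its stabilisation. -/
def StabilisesAfter (N l : ℕ) (F : ℕ → ℕ → WithOne S) : Prop :=
  ∀ (f : {e : S // IsIdempotentElem e}) (q : ℕ → ℕ) (k : ℕ), N < k → Monotone q → q k ≤ l →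
    (∀ j < k, F (q j) (q (j + 1)) ≤ (f : S)) → F (q 0) (q k) ≤ (stab f : S)

variable {F : ℕ → ℕ → WithOne S} {f : {e : S // IsIdempotentElem e}} {q : ℕ → ℕ} {k : ℕ}

lemma IsSubmul.le_idempotent (hF : IsSubmul F) (hq : Monotone q)
    (hf : ∀ j < k, F (q j) (q (j + 1)) ≤ (f : S)) {i j : ℕ} (hij : i < j) (hj : j ≤ k) :
    F (q i) (q j) ≤ (f : S) := by
  induction j, hij using Nat.le_induction with
  | base => exact hf i hj
  | succ j hij ih =>
    refine (hF.le_mul _ (q j) _ (hq (Nat.le_of_succ_le hij)) (hq (Nat.le_succ j))).trans ?_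
    rw [← coe_mul_self]
    exact mul_le_mul' (ih (by omega)) (hf j hj)

/-- The intervals on both sides have values at most `f`, which `f♯` absorbs. So it suffices to find
one stabilising stretch. -/
lemma IsSubmul.le_stab_of_le_stab (hF : IsSubmul F) (hq : Monotone q)
    (hf : ∀ j < k, F (q j) (q (j + 1)) ≤ (f : S)) {i j : ℕ} (hij : i ≤ j) (hj : j ≤ k)
    (h : F (q i) (q j) ≤ (stab f : S)) : F (q 0) (q k) ≤ (stab f : S) := by
  have h1 : F (q 0) (q j) ≤ (stab f : S) := by
    rcases Nat.eq_zero_or_pos i with rfl | hi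
    · exact h
    · refine (hF.le_mul _ (q i) _ (hq hi.le) (hq hij)).trans ?_
      rw [← coe_mul_stab]
      exact mul_le_mul' (hF.le_idempotent hq hf hi (hij.trans hj)) h
  rcases hj.eq_or_lt with rfl | hj'
  · exact h1
  · refine (hF.le_mul _ (q j) _ (hq (Nat.zero_le _)) (hq hj)).trans ?_
    rw [← coe_stab_mul]
    exact mul_le_mul' h1 (hF.le_idempotent hq hf hj' le_rfl)

lemma StabilisesAfter.translate {N l : ℕ} (hF : StabilisesAfter N l F) (s : ℕ) :
    StabilisesAfter N (s + l) fun a b => F (a - s) (b - s) := by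
  intro f q k hk hq hl h
  exact hF f (fun j => q j - s) k hk (fun i j hij => Nat.sub_le_sub_right (hq hij) s)
    (by omega) h

variable {o : ℕ → ℕ} {G : ℕ → ℕ → ℕ → WithOne S} {m : ℕ → ℕ → WithOne S}

/-- To show that a glued function stabilises, it is enough to consider sequences of positions in
pairwise distinct blocks. -/
lemma stabilisesAfter_glue {N L l : ℕ} (ho : StrictMono o) (h0 : o 0 = 0)
    (hF : IsSubmul (glue o G m)) (hG : ∀ i, StabilisesAfter N (o (i + 1)) (G i))
    (h : ∀ (f : {e : S // IsIdempotentElem e}) (q : ℕ → ℕ), Monotone q → q L ≤ l →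
      (∀ i j, i < j → j ≤ L → blockIndex o (q i) < blockIndex o (q j)) →
      (∀ i j, i < j → j ≤ L → glue o G m (q i) (q j) ≤ ((f : S) : WithOne S)) →
        glue o G m (q 0) (q L) ≤ ((stab f : S) : WithOne S)) :
    StabilisesAfter ((N + 1) * L) l (glue o G m) := by
  intro f q k hk hq hl hf
  -- Either `N + 1` consecutive intervals lie in one block, whose own function stabilises, or every
  -- `(N + 1)`-th position lies in a new block.
  by_cases hj : ∃ j, j + (N + 1) ≤ k ∧ blockIndex o (q j) = blockIndex o (q (j + (N + 1)))
  · obtain ⟨j, hjk, hj⟩ := hj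
    refine hF.le_stab_of_le_stab hq hf (Nat.le_add_right _ _) hjk ?_
    have hblock : ∀ i ≤ N + 1, blockIndex o (q (j + i)) = blockIndex o (q j) := fun i hi =>
      le_antisymm (hj ▸ blockIndex_mono ho h0 (hq (by omega)))
        (blockIndex_mono ho h0 (hq (by omega)))
    rw [glue_of_eq hj]
    refine hG _ f (fun i => q (j + i)) (N + 1) (Nat.lt_succ_self N)
      (fun a b hab => hq (by omega)) ?_ fun i hi => ?_
    · rw [hj]
      exact (lt_apply_blockIndex_succ ho _).le
    · have h2 := hf (j + i) (by omega)
      have h3 := hblock i hi.le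
      rw [glue_of_eq (h3.trans (hblock (i + 1) hi).symm :
        blockIndex o (q (j + i)) = blockIndex o (q (j + i + 1))), h3] at h2
      exact h2
  · push Not at hj
    refine hF.le_stab_of_le_stab hq hf (Nat.zero_le _) hk.le ?_
    have hq' : Monotone fun j => q ((N + 1) * j) := fun a b hab => hq (Nat.mul_le_mul_left _ hab)
    have hlt : ∀ i j, i < j → j ≤ L → (N + 1) * j ≤ k ∧ (N + 1) * i + (N + 1) ≤ (N + 1) * j :=
      fun i j hij hj => ⟨(Nat.mul_le_mul_left _ hj).trans hk.le, by
        rw [← Nat.mul_succ]; exact Nat.mul_le_mul_left _ hij⟩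
    refine h f (fun j => q ((N + 1) * j)) hq' ((hq hk.le).trans hl) (fun i j hij hjL => ?_)
      fun i j hij hjL => ?_
    · obtain ⟨h1, h2⟩ := hlt i j hij hjL
      exact ((blockIndex_mono ho h0 (hq (Nat.le_add_right _ _))).lt_of_ne (hj _ (h2.trans h1))).trans_le
        (blockIndex_mono ho h0 (hq h2))
    · obtain ⟨h1, h2⟩ := hlt i j hij hjL
      exact hF.le_idempotent hq hf (by omega) h1

/-- The bound on `L` serves two ends: more than `n` whole blocks between the outer positions, so
that the middle factor is `e♯`, and room for the pigeonhole. -/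
lemma glue_idempotentBlock_le_stab {n L : ℕ} {e : {e : S // IsIdempotentElem e}}
    (ho : StrictMono o) (h0 : o 0 = 0) (hG : ∀ i, IsSubmul (G i))
    (heG : ∀ i, ((e : S) : WithOne S) ≤ G i (o i) (o (i + 1)))
    (hL : n + 2 * Nat.card (WithOne S × WithOne S) + 4 ≤ L)
    (hb : ∀ i j, i < j → j ≤ L → blockIndex o (q i) < blockIndex o (q j))
    (hf : ∀ i j, i < j → j ≤ L →
      glue o G (idempotentBlock n e) (q i) (q j) ≤ ((f : S) : WithOne S)) :
    glue o G (idempotentBlock n e) (q 0) (q L) ≤ ((stab f : S) : WithOne S) := by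
  set C := Nat.card (WithOne S × WithOne S)
  let B := fun i => blockIndex o (q i)
  let color : ℕ → WithOne S × WithOne S := fun t =>
    (G (B t) (o (B t)) (q t), G (B t) (q t) (o (B t + 1)))
  obtain ⟨t, t', ht, htt, ht', hc, hd⟩ : ∃ t t', 2 ≤ t ∧ t + 2 ≤ t' ∧ t' + 2 ≤ L ∧
      G (B t) (o (B t)) (q t) = G (B t') (o (B t')) (q t') ∧
      G (B t) (q t) (o (B t + 1)) = G (B t') (q t') (o (B t' + 1)) := by
    -- The `C + 1` candidates `2, 4, …, 2 * C + 2` are two apart from each other and from `0` and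
    -- `L`, which leaves a whole block between any two of them.
    have hninj : ¬ Function.Injective fun x : Fin (C + 1) => color (2 * x.1 + 2) := fun hinj => by
      have := Nat.card_le_card_of_injective _ hinj
      simp only [Nat.card_fin] at this
      exact absurd this (Nat.not_succ_le_self C)
    rw [Function.not_injective_iff] at hninj
    obtain ⟨x, y, hcol, hne⟩ := hninj
    wlog hxy : x < y generalizing x y
    · exact this y x hcol.symm hne.symm (lt_of_le_of_ne (not_lt.1 hxy) hne.symm)
    have hy := y.2
    exact ⟨2 * x.1 + 2, 2 * y.1 + 2, by omega, by omega, by omega,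
      congrArg Prod.fst hcol, congrArg Prod.snd hcol⟩
  have hB2 : ∀ i j, i + 2 ≤ j → j ≤ L → B i + 1 < B j := fun i j hij hj => by
    have h1 := hb i (i + 1) (by omega) (by omega)
    have h2 := hb (i + 1) j (by omega) hj
    change blockIndex o (q i) + 1 < blockIndex o (q j)
    omega
  have hBL : ∀ j, j ≤ L → B 0 + j ≤ B j := fun j => by
    induction j with
    | zero => intro _; exact le_rfl
    | succ j ih =>
      intro hj
      have h1 := ih (by omega)
      have h2 : B j < B (j + 1) := hb j (j + 1) (by omega) hj
      omega
  have hpiece : ∀ i j, i + 2 ≤ j → j ≤ L →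
      G (B i) (q i) (o (B i + 1)) * (stab e : S) * G (B j) (o (B j)) (q j) ≤
        ((f : S) : WithOne S) := fun i j hij hj => by
    have h1 := hf i j (by omega) hj
    rw [glue_of_ne (hb i j (by omega) hj).ne] at h1
    refine le_trans ?_ h1
    have := stab_le_idempotentBlock (n := n) (e := e) (hB2 i j hij hj)
    gcongr
  have h0t := hpiece 0 t (by omega) (by omega)
  have htt' := hpiece t t' htt (by omega)
  have htL := hpiece t L (by omega) le_rfl
  rw [← hc] at htt'
  set c := G (B t) (o (B t)) (q t)
  set d := G (B t) (q t) (o (B t + 1))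
  have hcd : ((e : S) : WithOne S) ≤ c * d := (heG (B t)).trans
    ((hG _).le_mul _ _ _ (apply_blockIndex_le h0 _) (lt_apply_blockIndex_succ ho _).le)
  have hid := coe_mul_self (stab e)
  set g : WithOne S := ((stab e : S) : WithOne S) with hg
  -- Consistency is applied to the idempotent `e♯` rather than `e`; as `e♯♯ = e♯`, the left side
  -- remains `e♯`.
  have key : g ≤ g * c * (stab f : S) * (d * g) := by
    have h1 : g ≤ (g * c) * (d * g) := by
      calc g = g * g * g := by rw [hid, hid]
        _ ≤ g * (c * d) * g := by gcongr; exact (coe_stab_le e).trans hcd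
        _ = _ := by simp only [mul_assoc]
    have h2 : (d * g) * (g * c) ≤ ((f : S) : WithOne S) := by
      rw [mul_assoc, ← mul_assoc g, hid, ← mul_assoc]
      exact htt'
    have h3 := coe_stab_le_mul_stab_mul h1 h2
    rwa [stab_stab] at h3
  rw [glue_of_ne (hb 0 L (by omega) le_rfl).ne, idempotentBlock,
    if_neg (by have := hBL L le_rfl; change ¬ (B L ≤ B 0 + 1); omega),
    if_neg (by have := hBL L le_rfl; change ¬ (B L - (B 0 + 1) ≤ n); omega)]
  change G (B 0) (q 0) (o (B 0 + 1)) * g * G (B L) (o (B L)) (q L) ≤ _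
  calc G (B 0) (q 0) (o (B 0 + 1)) * g * G (B L) (o (B L)) (q L)
      ≤ G (B 0) (q 0) (o (B 0 + 1)) * (g * c * (stab f : S) * (d * g)) *
          -- After regrouping, the factors to the left and to the right of `f♯` are bounds from
          -- `hpiece` for `0, t` and `t, L`.
          G (B L) (o (B L)) (q L) := by gcongr
    _ = (G (B 0) (q 0) (o (B 0 + 1)) * g * c) * (stab f : S) *
          (d * g * G (B L) (o (B L)) (q L)) := by simp only [mul_assoc]
    _ ≤ (f : S) * (stab f : S) * (f : S) := by gcongr
    _ = (stab f : S) := by rw [coe_mul_stab, coe_stab_mul]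

end stabilisation

/-! ### Positions of the leaves below the children of a node -/

lemma length_flatMap_range {α : Type*} (g : ℕ → List α) (k : ℕ) :
    ((List.range k).flatMap g).length = ∑ j ∈ Finset.range k, (g j).length := by
  induction k with
  | zero => simp
  | succ k ih => simp [List.range_succ, Finset.sum_range_succ, ih]

lemma getElem?_flatMap_range {α : Type*} (g : ℕ → List α) {k i r : ℕ} (hi : i < k)
    (hr : r < (g i).length) :
    ((List.range k).flatMap g)[(∑ j ∈ Finset.range i, (g j).length) + r]? = (g i)[r]? := by
  induction k with
  | zero => omega
  | succ k ih =>
    rw [List.range_succ, List.flatMap_append]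
    rcases Nat.lt_succ_iff_lt_or_eq.1 hi with h | rfl
    · have hlt : (∑ j ∈ Finset.range i, (g j).length) + r < ((List.range k).flatMap g).length := by
        rw [length_flatMap_range]
        calc _ < ∑ j ∈ Finset.range (i + 1), (g j).length := by
              rw [Finset.sum_range_succ]; omega
          _ ≤ _ := Finset.sum_le_sum_of_subset (Finset.range_subset_range.2 h)
      rw [List.getElem?_append_left hlt, ih h]
    · rw [List.getElem?_append_right (by rw [length_flatMap_range]; omega), length_flatMap_range]
      simp

namespace ValuedTree

variable {S : Type*}

/-- The children of a node, continued periodically to all indices. -/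
def periodicChild {k : ℕ} (c : Fin (k + 1) → ValuedTree S) (i : ℕ) : ValuedTree S :=
  c (Fin.ofNat (k + 1) i)

lemma periodicChild_val {k : ℕ} (c : Fin (k + 1) → ValuedTree S) (i : Fin (k + 1)) :
    periodicChild c i = c i := by
  simp [periodicChild]

lemma leafValues_node_succ (v : S) {k : ℕ} (c : Fin (k + 1) → ValuedTree S) :
    (node v (k + 1) c).leafValues =
      (List.range (k + 1)).flatMap fun i => (periodicChild c i).leafValues := by
  rw [leafValues, List.flatMap_def, List.ofFn_eq_map, ← List.map_coe_finRange_eq_range,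
    List.map_map]
  congr 2
  funext i
  simp [periodicChild_val]

lemma length_leafValues_pos (T : ValuedTree S) : 0 < T.leafValues.length := by
  induction T with
  | node v k c ih =>
    cases k with
    | zero => simp [leafValues]
    | succ k =>
      rw [leafValues_node_succ, length_flatMap_range]
      exact Finset.sum_pos (fun i _ => ih _) ⟨0, by simp⟩

/-- The number of leaves below the first `i` children of a node. -/
def childOffset {k : ℕ} (c : Fin (k + 1) → ValuedTree S) (i : ℕ) : ℕ :=
  ∑ j ∈ Finset.range i, (periodicChild c j).leafValues.length

variable {k : ℕ} (c : Fin (k + 1) → ValuedTree S)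

lemma childOffset_zero : childOffset c 0 = 0 := by simp [childOffset]

lemma childOffset_succ (i : ℕ) :
    childOffset c (i + 1) = childOffset c i + (periodicChild c i).leafValues.length :=
  Finset.sum_range_succ _ _

lemma childOffset_strictMono : StrictMono (childOffset c) :=
  strictMono_nat_of_lt_succ fun i => by
    rw [childOffset_succ]
    exact Nat.lt_add_of_pos_right (length_leafValues_pos _)

lemma length_leafValues_node (v : S) :
    (node v (k + 1) c).leafValues.length = childOffset c (k + 1) := by
  rw [leafValues_node_succ, length_flatMap_range, childOffset]

lemma getElem?_leafValues_node (v : S) {i r : ℕ} (hi : i < k + 1)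
    (hr : r < (periodicChild c i).leafValues.length) :
    (node v (k + 1) c).leafValues[childOffset c i + r]? = (periodicChild c i).leafValues[r]? := by
  rw [leafValues_node_succ, childOffset]
  exact getElem?_flatMap_range (fun i => (periodicChild c i).leafValues) hi hr

end ValuedTree

open ValuedTree

/-! ### Interval functions extending an under-computation -/

/-- The number of intervals after which the interval function of an under-computation of height
at most `p` stabilises, as a polynomial in the threshold. -/
noncomputable def stabilisationBound (S : Type*) : ℕ → Polynomial ℕ
  | 0 => 1
  | p + 1 => (stabilisationBound S p + 1) *
      (Polynomial.X + Polynomial.C (2 * Nat.card (WithOne S × WithOne S) + 4))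

lemma eval_stabilisationBound_succ (S : Type*) (p n : ℕ) :
    (stabilisationBound S (p + 1)).eval n =
    ((stabilisationBound S p).eval n + 1) *
      (n + 2 * Nat.card (WithOne S × WithOne S) + 4) := by
  simp only [stabilisationBound, Polynomial.eval_mul, Polynomial.eval_add, Polynomial.eval_X,
    Polynomial.eval_C, Polynomial.eval_one]
  ring

lemma one_le_eval_stabilisationBound (S : Type*) (p n : ℕ) : 1 ≤ (stabilisationBound S p).eval n := by
  cases p with
  | zero => simp [stabilisationBound]
  | succ p =>
    rw [eval_stabilisationBound_succ]
    exact Nat.mul_pos (Nat.succ_pos _) (by omega)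

section underComputation

variable {S : Type*} [StabilisationSemigroup S]

/-- The interval function `F` extends the tree `T`: it is bounded by the leaves on singletons,
bounds the value of `T` on the full interval, is submultiplicative and stabilises after `N`
intervals. -/
structure Extends (N : ℕ) (T : ValuedTree S) (F : ℕ → ℕ → WithOne S) : Prop where
  isSubmul : IsSubmul F
  stabilises : StabilisesAfter N T.leafValues.length F
  le_leaf : ∀ (i : ℕ) (x : S), T.leafValues[i]? = some x → F i (i + 1) ≤ x
  value_le : (T.value : WithOne S) ≤ F 0 T.leafValues.length

/-- Stabilisation is vacuous: of two or more consecutive intervals inside `[0, 1]`, one is empty and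
has value `1`, which is not below any `f`. -/
lemma exists_extends_leaf {N : ℕ} (hN : 1 ≤ N) (v : S) (c : Fin 0 → ValuedTree S) :
    ∃ F, Extends N (node v 0 c) F := by
  refine ⟨fun a b => if a = 0 ∧ 0 < b then v else 1, ⟨fun a => ?_, fun a b c hab hbc => ?_⟩,
    fun f q k hk hq hl h => ?_, fun i x hx => ?_, ?_⟩
  · rw [if_neg (by omega)]
  · rcases Nat.eq_zero_or_pos a with rfl | ha
    · rcases Nat.eq_zero_or_pos b with rfl | hb
      · simp
      · simp [hb, hb.trans_le hbc, hb.ne']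
    · simp [ha.ne', (ha.trans_le hab).ne']
  · exfalso
    have h01 := hq (Nat.zero_le 1)
    have h12 := hq (show 1 ≤ 2 by omega)
    have h2k := hq (show 2 ≤ k by omega)
    have hk1 : q k ≤ 1 := by simpa [leafValues] using hl
    rcases Nat.eq_zero_or_pos (q 1) with h1 | h1
    · have := h 0 (by omega)
      rw [if_neg (by simp [h1])] at this
      exact WithOne.not_one_le_coe _ this
    · have := h 1 (by omega)
      rw [if_neg (by omega)] at this
      exact WithOne.not_one_le_coe _ this
  · have : i = 0 ∧ v = x := by
      cases i <;> simp_all [leafValues]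
    obtain ⟨rfl, rfl⟩ := this
    simp
  · simp [leafValues, value]

/-- Common to all kinds of inner nodes, which differ only in `m`, the value of a run of whole
children. `hstab` is asked for arbitrary `G` because the functions of the children are translated to
their offsets inside the proof. -/
lemma exists_extends_node {N L k : ℕ} (v : S) (c : Fin (k + 1) → ValuedTree S)
    (H : ℕ → ℕ → ℕ → WithOne S) (hH : ∀ i, Extends N (periodicChild c i) (H i))
    (m : ℕ → ℕ → WithOne S) (hm : IsSubmul m)
    (hmv : ∀ i, m i (i + 1) ≤ (periodicChild c i).value) (hv : (v : WithOne S) ≤ m 0 (k + 1))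
    (hstab : ∀ (G : ℕ → ℕ → ℕ → WithOne S) (f : {e : S // IsIdempotentElem e}) (q : ℕ → ℕ),
      (∀ i, IsSubmul (G i)) →
      (∀ i, ((periodicChild c i).value : WithOne S) ≤
        G i (childOffset c i) (childOffset c (i + 1))) →
      q L ≤ childOffset c (k + 1) →
      (∀ i j, i < j → j ≤ L →
        blockIndex (childOffset c) (q i) < blockIndex (childOffset c) (q j)) →
      (∀ i j, i < j → j ≤ L → glue (childOffset c) G m (q i) (q j) ≤ ((f : S) : WithOne S)) →
        glue (childOffset c) G m (q 0) (q L) ≤ ((stab f : S) : WithOne S)) :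
    ∃ F, Extends ((N + 1) * L) (node v (k + 1) c) F := by
  have ho := childOffset_strictMono c
  have h0 := childOffset_zero c
  let G : ℕ → ℕ → ℕ → WithOne S := fun i a b => H i (a - childOffset c i) (b - childOffset c i)
  have hG : ∀ i, IsSubmul (G i) := fun i => (hH i).isSubmul.translate _
  have hvG : ∀ i, ((periodicChild c i).value : WithOne S) ≤
      G i (childOffset c i) (childOffset c (i + 1)) := fun i => by
    have := (hH i).value_le
    simpa only [G, childOffset_succ, Nat.sub_self, Nat.add_sub_cancel_left] using this
  have hmG := fun i => (hmv i).trans (hvG i)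
  have hF := IsSubmul.glue ho h0 hG hm hmG
  refine ⟨glue (childOffset c) G m, hF, ?_, fun a x hx => ?_, ?_⟩
  · rw [length_leafValues_node]
    refine stabilisesAfter_glue ho h0 hF (fun i => ?_) fun f q _ hq hb hf =>
      hstab G f q hG hvG hq hb hf
    rw [childOffset_succ]
    exact (hH i).stabilises.translate _
  · set i := blockIndex (childOffset c) a with hi
    have h1 : childOffset c i ≤ a := apply_blockIndex_le h0 a
    have h2 : a < childOffset c (i + 1) := lt_apply_blockIndex_succ ho a
    have ha : a < childOffset c (k + 1) := by
      rw [← length_leafValues_node c v]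
      exact (List.getElem?_eq_some_iff.1 hx).1
    have hik : i < k + 1 := ho.lt_iff_lt.1 (h1.trans_lt ha)
    obtain ⟨r, hr⟩ := Nat.exists_eq_add_of_le h1
    rw [childOffset_succ] at h2
    have hGa : G i a (a + 1) ≤ x := by
      rw [hr, getElem?_leafValues_node c v hik (by omega)] at hx
      have := (hH i).le_leaf r x hx
      have e1 : a - childOffset c i = r := by omega
      have e2 : a + 1 - childOffset c i = r + 1 := by omega
      simpa only [G, e1, e2] using this
    by_cases hb : blockIndex (childOffset c) a = blockIndex (childOffset c) (a + 1)
    · rw [glue_of_eq hb]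
      exact hGa
    -- The letter is the last one of its child, so `a + 1` already belongs to the next block, and
    -- the last two factors of `glue` are `1`.
    · have h3 : a + 1 = childOffset c (i + 1) := by
        by_contra hne
        refine hb (blockIndex_eq ho h0 (h1.trans (Nat.le_succ a)) ?_).symm
        rw [← hi, childOffset_succ] at *
        omega
      have h4 : blockIndex (childOffset c) (a + 1) = i + 1 := by rw [h3, blockIndex_apply ho h0]
      rw [glue_of_ne hb, h4, ← hi, ← h3, hm.self, (hG _).self, mul_one, mul_one]
      exact hGa
  · rw [length_leafValues_node]
    have h1 : blockIndex (childOffset c) 0 = 0 := by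
      have := blockIndex_apply ho h0 0
      rwa [h0] at this
    have h2 := blockIndex_apply ho h0 (k + 1)
    rw [glue_of_ne (by omega), h1, h2, (hG _).self, mul_one]
    refine hv.trans ((hm.le_mul 0 1 (k + 1) (by omega) (by omega)).trans ?_)
    have := hmG 0
    rw [h0] at this
    gcongr

lemma exists_extends (n : ℕ) (T : ValuedTree S) (p : ℕ) (hp : T.height ≤ p)
    (hT : T.ForallInner (InnerNodeRule (fun v a => v ≤ a) n)) :
    ∃ F, Extends ((stabilisationBound S p).eval n) T F := by
  induction T generalizing p with
  | node v k c ih =>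
    cases k with
    | zero => exact exists_extends_leaf (one_le_eval_stabilisationBound S p n) v c
    | succ k =>
      rw [height] at hp
      have hp' : ∀ i, (c i).height + 1 ≤ p := fun i =>
        (Finset.le_sup (f := fun i => (c i).height + 1) (Finset.mem_univ i)).trans hp
      obtain ⟨p, rfl⟩ : ∃ p', p = p' + 1 := ⟨p - 1, by have := hp' 0; omega⟩
      rw [ForallInner] at hT
      obtain ⟨hrule, hchild⟩ := hT
      have hex : ∀ i : ℕ, ∃ F, Extends ((stabilisationBound S p).eval n) (periodicChild c i) F :=
        fun i => ih _ p (by have := hp' (Fin.ofNat (k + 1) i); omega) (hchild _)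
      choose H hH using hex
      have hidem : ∀ e : {e : S // IsIdempotentElem e},
          (∀ y ∈ List.ofFn fun i => (c i).value, y = (e : S)) →
          (v : WithOne S) ≤ idempotentBlock n e 0 (k + 1) →
          ∃ F, Extends ((stabilisationBound S (p + 1)).eval n) (node v (k + 1) c) F := by
        intro e he hv
        have he' : ∀ i, (periodicChild c i).value = e := fun i =>
          he _ ((List.mem_ofFn' _ _).2 ⟨_, rfl⟩)
        rw [eval_stabilisationBound_succ]
        refine exists_extends_node v c H hH _ (isSubmul_idempotentBlock n e) (fun i => ?_) hv
          fun G f q hG hvG _ hb hf => ?_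
        · rw [he']
          exact idempotentBlock_le (Nat.lt_succ_self i)
        · simp only [he'] at hvG
          exact glue_idempotentBlock_le_stab (childOffset_strictMono c) (childOffset_zero c) hG hvG
            le_rfl hb hf
      rcases hrule (Nat.succ_ne_zero k) with ⟨y₁, y₂, hy, hv⟩ | ⟨e, h2, hn, he, hv⟩ | ⟨e, hn, he, hv⟩
      · have hk : k = 1 := by simpa using congrArg List.length hy
        subst hk
        obtain ⟨rfl, rfl⟩ : (c 0).value = y₁ ∧ (c 1).value = y₂ := by
          simpa [List.ofFn_succ] using hy
        rw [eval_stabilisationBound_succ]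
        refine exists_extends_node v c H hH _
          (isSubmul_prod fun i => ((periodicChild c i).value : WithOne S)) (fun i => ?_) ?_
          fun G f q _ _ hq hb _ => ?_
        · simp
        · simpa [List.range'_succ, periodicChild, ← WithOne.coe_mul, WithOne.coe_le_coe] using hv
        -- With two children, positions up to the end of the word have block index at most `2`, the
        -- end itself having index `2`; so `q 0`, `q 1`, `q 2`, `q L` cannot lie in distinct blocks.
        · exfalso
          have h0 := childOffset_zero c
          have ho := childOffset_strictMono c
          set L := n + 2 * Nat.card (WithOne S × WithOne S) + 4
          have hL := blockIndex_mono ho h0 hq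
          rw [blockIndex_apply ho h0] at hL
          have h1 := hb 0 1 (by omega) (by omega)
          have h2 := hb 1 2 (by omega) (by omega)
          have h3 := hb 2 L (by omega) le_rfl
          omega
      · refine hidem e he ?_
        rw [List.length_ofFn] at hn
        rw [idempotentBlock, if_neg (by omega), if_pos (by omega), WithOne.coe_le_coe]
        exact hv
      · refine hidem e he ?_
        rw [List.length_ofFn] at hn
        rw [idempotentBlock, if_neg (by omega), if_neg (by omega), WithOne.coe_le_coe]
        exact hv

end underComputation

/-! ### Comparison with an over-computation -/

section overComputation

variable {S : Type*} [StabilisationSemigroup S]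

/-- Each kind of node matches a property of `F`: submultiplicativity for binary nodes,
`le_idempotent` for idempotent nodes, `hs` for stabilisation nodes. Nothing is lost from one level
to the next, so the height of `U` plays no role. -/
lemma le_value_of_forallInner {N l : ℕ} {F : ℕ → ℕ → WithOne S} (hF : IsSubmul F)
    (hs : StabilisesAfter N l F) (U : ValuedTree S) (a : ℕ)
    (hU : U.ForallInner (InnerNodeRule (fun v a => v ≥ a) N))
    (hl : a + U.leafValues.length ≤ l)
    (hleaf : ∀ (i : ℕ) (x : S), U.leafValues[i]? = some x → F (a + i) (a + i + 1) ≤ x) :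
    F a (a + U.leafValues.length) ≤ U.value := by
  induction U generalizing a with
  | node v k c ih =>
    cases k with
    | zero => exact hleaf 0 v rfl
    | succ k =>
      rw [ForallInner] at hU
      obtain ⟨hrule, hchild⟩ := hU
      rw [length_leafValues_node] at hl ⊢
      let q : ℕ → ℕ := fun i => a + childOffset c i
      have ho := (childOffset_strictMono c).monotone
      have hq : Monotone q := fun i j hij => Nat.add_le_add_left (ho hij) a
      have hpiece : ∀ i < k + 1, F (q i) (q (i + 1)) ≤ (periodicChild c i).value := by
        intro i hi
        have := ih (Fin.ofNat (k + 1) i) (q i) (hchild _) ?_ fun r x hx => ?_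
        · simpa only [q, childOffset_succ, add_assoc, periodicChild] using this
        · refine le_trans ?_ hl
          change a + childOffset c i + (periodicChild c i).leafValues.length ≤ _
          rw [add_assoc, ← childOffset_succ]
          exact Nat.add_le_add_left (ho hi) a
        · have hr : r < (periodicChild c i).leafValues.length := (List.getElem?_eq_some_iff.1 hx).1
          have := hleaf (childOffset c i + r) x (by rw [getElem?_leafValues_node c v hi hr]; exact hx)
          simpa only [q, add_assoc] using this
      have hidem : ∀ e : {e : S // IsIdempotentElem e},
          (∀ y ∈ List.ofFn fun i => (c i).value, y = (e : S)) →
          ∀ i < k + 1, F (q i) (q (i + 1)) ≤ (e : S) := fun e he i hi => by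
        rw [← he (periodicChild c i).value ((List.mem_ofFn' _ _).2 ⟨_, rfl⟩)]
        exact hpiece i hi
      have hq0 : q 0 = a := by simp [q, childOffset_zero]
      change F a (q (k + 1)) ≤ v
      rw [← hq0]
      rcases hrule (Nat.succ_ne_zero k) with ⟨y₁, y₂, hy, hv⟩ | ⟨e, h2, hn, he, hv⟩ | ⟨e, hn, he, hv⟩
      · have hk : k = 1 := by simpa using congrArg List.length hy
        subst hk
        obtain ⟨rfl, rfl⟩ : (c 0).value = y₁ ∧ (c 1).value = y₂ := by
          simpa [List.ofFn_succ] using hy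
        refine le_trans ?_ (WithOne.coe_le_coe.2 hv)
        rw [WithOne.coe_mul]
        exact (hF.le_mul _ (q 1) _ (hq (by omega)) (hq (by omega))).trans
          (mul_le_mul' (hpiece 0 (by omega)) (hpiece 1 (by omega)))
      · exact (hF.le_idempotent hq (hidem e he) (Nat.succ_pos k) le_rfl).trans
          (WithOne.coe_le_coe.2 hv)
      · rw [List.length_ofFn] at hn
        exact (hs e q (k + 1) hn hq hl (hidem e he)).trans (WithOne.coe_le_coe.2 hv)

end overComputation

theorem mainTheorem3 {S : Type*} [StabilisationSemigroup S] (p : ℕ) :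
    ∃ α : Polynomial ℕ, ∀ (n : ℕ) (u : List S) (T U : ValuedTree S),
      IsUnderComputation n T u → T.height ≤ p →
      IsOverComputation (α.eval n) U u →
      T.value ≤ U.value := by
  refine ⟨stabilisationBound S p, fun n u T U hT hp hU => ?_⟩
  obtain ⟨F, hF⟩ := exists_extends n T p hp hT.2
  have hlT := hT.1.length_eq
  have hlU := hU.1.length_eq
  have hle := le_value_of_forallInner hF.isSubmul hF.stabilises U 0 hU.2 (by omega)
    fun i x hx => ?_
  · rw [zero_add, hlU, ← hlT] at hle
    exact WithOne.coe_le_coe.1 (hF.value_le.trans hle)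
  · obtain ⟨hi, rfl⟩ := List.getElem?_eq_some_iff.1 hx
    rw [zero_add]
    have hiT : i < T.leafValues.length := by omega
    have hiu : i < u.length := by omega
    refine (hF.le_leaf i _ (List.getElem?_eq_getElem hiT)).trans (WithOne.coe_le_coe.2 ?_)
    have h1 : T.leafValues[i] ≤ u[i] := (List.forall₂_iff_get.1 hT.1).2 i hiT hiu
    have h2 : U.leafValues[i] ≥ u[i] := (List.forall₂_iff_get.1 hU.1).2 i hi hiu
    exact h1.trans h2
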